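/- Let $X_1,X_2,\dots$ be iid real random variables whose law has a probability density $f$, and let $F_0$ be a target cdf with probability density $f_0$. Let $\mathcal K:\mathbb R\to\mathbb R$ be a kernel, that is, a bounded integrable measurable function with $\int\mathcal K=1$, which is either nonnegative or of order at least $k$ (meaning $\int |u|^k|\mathcal K(u)|\,du<\infty$ and $\int u^j\mathcal K(u)\,du=0$ for $1\le j<k$), where $k\ge 1$ is the integer in (C) below. Let $h_n>0$ be bandwidths and $e_n>0$ a trimming sequence with $e_n\to0$. Put $$\widehat f(y)=\frac1{nh_n}\sum_{j=1}^n\mathcal K\Big(\frac{X_j-y}{h_n}\Big),\qquad \omega_i=\frac{f_0(X_i)}{\max(\widehat f(X_i),e_n)},\qquad q_i=\frac{\omega_i}{\sum_{j=1}^n\omega_j},$$ let $X^*$ be drawn from $X_1,\dots,X_n$ with probabilities $q_1,\dots,q_n$, and let $F^*(x)=\sum_{i=1}^n q_i\mathbf 1_{\{X_i\le x\}}$ be the cdf of $X^*$ given $X_1,\dots,X_n$ (with $q_i=0$ for all $i$ if all $\omega_j$ vanish). Assume (C) for some integer $k\ge1$, $f$ is of class $C^k$ on $\mathbb R$ with bounded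 $k$-th derivative, and $h_n^k+\frac{\log n}{nh_n}=O(e_n^2)$; and assume that the support $\{f>0\}$ of $F$ contains the support $\{f_0>0\}$ of $F_0$, up to a Lebesgue-null set. Then for every $x\in\mathbb R$, $F^*(x)$ converges in probability to $F_0(x)$ as $n\to\infty$. -/

import Mathlib

open MeasureTheory ProbabilityTheory Filter Topology Asymptotics

namespace WeightedResampling

/-- `K` has order at least `k`: its `k`-th absolute moment is finite and its moments of
orders `1, …, k - 1` vanish. -/
def HasOrder (k : ℕ) (K : ℝ → ℝ) : Prop :=
  Integrable (fun u => u ^ k * K u) ∧ ∀ j : ℕ, 1 ≤ j → j < k → ∫ u, u ^ j * K u = 0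

/-- The classical kernels: bounded measurable functions, integrable with integral `1`, which are
either probability densities or (possibly signed) kernels of order at least `k`. -/
structure IsClassicalKernel (k : ℕ) (K : ℝ → ℝ) : Prop where
  measurable : Measurable K
  bounded : ∃ B : ℝ, ∀ u, |K u| ≤ B
  integrable : Integrable K
  integral_eq_one : ∫ u, K u = 1
  nonneg_or_order : (∀ u, 0 ≤ K u) ∨ HasOrder k K

/-- `f` is a probability density (with respect to Lebesgue measure) of the measure `P`. -/
structure IsDensityOf (f : ℝ → ℝ) (P : Measure ℝ) : Prop where
  measurable : Measurable f
  nonneg : ∀ y, 0 ≤ f y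
  eq_withDensity : P = volume.withDensity (fun y => ENNReal.ofReal (f y))

/-- Condition (C) with exponent `k`: `f` is of class `C^k`, with bounded `k`-th derivative, and
`h_n ^ k + log n / (n h_n) = O(e_n ^ 2)`. -/
structure ConditionC (k : ℕ) (f : ℝ → ℝ) (h e : ℕ → ℝ) : Prop where
  one_le : 1 ≤ k
  contDiff : ContDiff ℝ k f
  bounded_deriv : ∃ M : ℝ, ∀ y, |iteratedDeriv k f y| ≤ M
  rate : (fun n : ℕ => h n ^ k + Real.log n / (n * h n)) =O[atTop] (fun n : ℕ => e n ^ 2)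

noncomputable section

/-- The kernel density estimator with kernel `K` and bandwidth `h` built on the sample `s`. -/
def kde (K : ℝ → ℝ) (h : ℝ) {n : ℕ} (s : Fin n → ℝ) (y : ℝ) : ℝ :=
  1 / (n * h) * ∑ j, K ((s j - y) / h)

/-- The kernel density estimator trimmed from below at level `e`. -/
def trimmedKde (K : ℝ → ℝ) (h e : ℝ) {n : ℕ} (s : Fin n → ℝ) (y : ℝ) : ℝ :=
  max (kde K h s y) e

/-- The drawing weight of observation `i`. -/
def weight (f₀ K : ℝ → ℝ) (h e : ℝ) {n : ℕ} (s : Fin n → ℝ) (i : Fin n) : ℝ :=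
  f₀ (s i) / trimmedKde K h e s (s i)

/-- The normalized drawing weight of observation `i`
(equal to `0` by convention if all the drawing weights vanish). -/
def drawProb (f₀ K : ℝ → ℝ) (h e : ℝ) {n : ℕ} (s : Fin n → ℝ) (i : Fin n) : ℝ :=
  weight f₀ K h e s i / ∑ j, weight f₀ K h e s j

/-- The law, given the sample `s`, of the weighted-resampling draw: observation `i` is drawn with
probability `drawProb f₀ K h e s i`. -/
def drawLaw (f₀ K : ℝ → ℝ) (h e : ℝ) {n : ℕ} (s : Fin n → ℝ) : Measure ℝ :=
  ∑ i, ENNReal.ofReal (drawProb f₀ K h e s i) • Measure.dirac (s i)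

/-- The cdf, given the sample `s`, of the weighted-resampling draw. -/
def drawCdf (f₀ K : ℝ → ℝ) (h e : ℝ) {n : ℕ} (s : Fin n → ℝ) (x : ℝ) : ℝ :=
  (drawLaw f₀ K h e s).real (Set.Iic x)

end

end WeightedResampling

/-! Write F*(x) = A_n / B_n, where B_n is the average of the ω_i and A_n the average of the ω_i with
X_i ≤ x. If ω_i were the exact ratio f₀(X_i)/f(X_i), importance sampling and the law of large
numbers would give A_n → F₀(x) and B_n → 1. It remains to show that the average of |ω_i −
f₀(X_i)/f(X_i)| tends to 0 in mean (`tendstoInMeasure_average_weight_error`).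

No uniform convergence of the kernel estimator is needed. Given X_i = y, the other observations are
still iid, so the mean error of one weight is at most the P-integral of (f₀/f)(y) times the mean of
|f(y)/max(f̂(y), e_n) − 1|. As f₀/f is P-integrable, dominated convergence only asks that this
relative error vanish pointwise where f > 0 and be bounded uniformly in y for large n.

The pointwise limit follows from a variance of order 1/(n h_n) = O(e_n²) and a mean tending to f(y).
The uniform bound needs c f(y) ≤ E f̂(y) + D e_n: smoothing must not destroy the mass near y. For a
kernel of order k, Taylor's formula gives this for the smoothed density with c = 1. For a
nonnegative kernel the intermediate Taylor terms survive, but norms on polynomials of degree < k are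
equivalent: the constant term is controlled by the L¹ norm against the truncated kernel, with one
constant for all bandwidths, and since f ≥ 0 that norm is at most the local average of f plus O(h^k)
(`exists_mul_le_integral_add`). -/

namespace WeightedResampling

/-! ### Taylor expansion with a uniform remainder -/

section Taylor

/-- Taylor's theorem at every base point of the line, with a uniform polynomial remainder. -/
theorem exists_uniform_taylor_bound {k : ℕ} (hk : 1 ≤ k) {f : ℝ → ℝ} (hf : ContDiff ℝ k f)
    {M : ℝ} (hM : ∀ y, |iteratedDeriv k f y| ≤ M) :
    ∃ a : ℝ → ℕ → ℝ, ∃ C : ℝ, 0 ≤ C ∧ (∀ y, a y 0 = f y) ∧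
      ∀ y t, |f (y + t) - ∑ j ∈ Finset.range k, a y j * t ^ j| ≤ C * |t| ^ k := by
  have hM0 : 0 ≤ M := (abs_nonneg _).trans (hM 0)
  refine ⟨fun y j => (j.factorial : ℝ)⁻¹ * iteratedDeriv j f y, M, hM0, fun y => by simp, ?_⟩
  intro y t
  obtain ⟨n, rfl⟩ : ∃ n, k = n + 1 := ⟨k - 1, by omega⟩
  -- The Lagrange remainder needs distinct endpoints; at `t = 0` only the term `j = 0` survives.
  rcases eq_or_ne t 0 with rfl | ht
  · rw [Finset.sum_eq_single 0]
    · simp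
    · intro j _ hj
      simp [hj]
    · simp
  have hx : y ≠ y + t := by simpa using ht
  have hf' : ContDiff ℝ ((n : WithTop ℕ∞) + 1) f := by exact_mod_cast hf
  obtain ⟨z, -, hz⟩ := taylor_mean_remainder_lagrange_iteratedDeriv hx hf'.contDiffOn
  have hpoly : taylorWithinEval f n (Set.uIcc y (y + t)) y (y + t) =
      ∑ j ∈ Finset.range (n + 1), (j.factorial : ℝ)⁻¹ * iteratedDeriv j f y * t ^ j := by
    rw [taylor_within_apply]
    refine Finset.sum_congr rfl fun j hj => ?_
    rw [iteratedDerivWithin_eq_iteratedDeriv (uniqueDiffOn_uIcc hx) _ Set.left_mem_uIcc]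
    · simp only [add_sub_cancel_left, smul_eq_mul]
      ring
    · refine (hf.contDiffAt).of_le ?_
      exact_mod_cast (Finset.mem_range.1 hj).le
  rw [← hpoly, hz, add_sub_cancel_left, abs_div, abs_mul, abs_pow]
  have h1 : (1 : ℝ) ≤ |((n + 1).factorial : ℝ)| := by
    rw [Nat.abs_cast]
    exact_mod_cast Nat.one_le_iff_ne_zero.2 (Nat.factorial_ne_zero _)
  calc _ ≤ |iteratedDeriv (n + 1) f z| * |t| ^ (n + 1) := div_le_self (by positivity) h1
    _ ≤ _ := by gcongr; exact hM z

end Taylor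

/-! ### Equivalence of norms on polynomials and local averages -/

section NormEquivalence

variable {ν : Measure ℝ}

/-- A real polynomial which vanishes almost everywhere for a nonzero absolutely continuous measure
has a vanishing coefficient vector. -/
theorem coeff_eq_zero_of_ae_eq_zero (hν : ν ≪ volume) (hν0 : ν ≠ 0) {k : ℕ} (b : Fin k → ℝ)
    (hb : ∀ᵐ u ∂ν, ∑ j, b j * u ^ (j : ℕ) = 0) : b = 0 := by
  classical
  let p : Polynomial ℝ := ∑ j : Fin k, Polynomial.monomial (j : ℕ) (b j)
  have hp : ∀ u, p.eval u = ∑ j, b j * u ^ (j : ℕ) := fun u => by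
    simp [p, Polynomial.eval_finsetSum]
  have hp0 : p = 0 := by
    by_contra hne
    have hfin : {u | p.eval u = 0}.Finite := by
      refine (p.roots.toFinset.finite_toSet).subset fun u hu => ?_
      simpa [hne, Polynomial.IsRoot] using hu
    have h0 : ν {u | p.eval u = 0} = 0 := hν (hfin.measure_zero volume)
    refine hν0 (Measure.measure_univ_eq_zero.1 ?_)
    refine measure_mono_null (fun u _ => ?_) (measure_union_null h0 hb)
    by_cases h : p.eval u = 0
    · exact Or.inl h
    · exact Or.inr (by simpa [hp] using h)
  ext i
  have := congrArg (fun q => Polynomial.coeff q (i : ℕ)) hp0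
  simpa [p, Polynomial.finsetSum_coeff, Polynomial.coeff_monomial, Fin.val_inj] using this

/-- The value at the origin of a polynomial of degree `< k` is controlled by its `L¹` norm, for a
nonzero absolutely continuous measure with finite moments. -/
theorem exists_abs_coeff_zero_le_integral (hν : ν ≪ volume) (hν0 : ν ≠ 0) {k : ℕ} (hk : 1 ≤ k)
    (hint : ∀ j < k, Integrable (fun u : ℝ => u ^ j) ν) :
    ∃ c : ℝ, 0 < c ∧ ∀ b : ℕ → ℝ,
      c * |b 0| ≤ ∫ u, |∑ j ∈ Finset.range k, b j * u ^ j| ∂ν := by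
  -- An injective linear map on a finite-dimensional space is bounded below; applied to coefficients
  -- ↦ polynomial in L¹, this yields `c`.
  let L : (Fin k → ℝ) →ₗ[ℝ] (ℝ →₁[ν] ℝ) :=
    ∑ j : Fin k, (LinearMap.proj j : (Fin k → ℝ) →ₗ[ℝ] ℝ).smulRight ((hint j j.2).toL1 _)
  have hL : ∀ b, (L b : ℝ → ℝ) =ᵐ[ν] fun u => ∑ j, b j * u ^ (j : ℕ) := by
    intro b
    have h1 : L b = ∑ j : Fin k, b j • (hint j j.2).toL1 _ := by simp [L]
    have h2 : L b = (integrable_finsetSum Finset.univ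
        (fun (j : Fin k) _ => (hint j j.2).const_mul (b j))).toL1 _ := by
      rw [h1]
      apply Lp.ext
      refine (Lp.coeFn_finsetSum _ _).trans ?_
      refine EventuallyEq.trans ?_ (Integrable.coeFn_toL1 _).symm
      have : ∀ j : Fin k, ((b j • (hint j j.2).toL1 _ : ℝ →₁[ν] ℝ) : ℝ → ℝ) =ᵐ[ν]
          fun u => b j * u ^ (j : ℕ) := fun j => by
        filter_upwards [Lp.coeFn_smul (b j) ((hint j j.2).toL1 _),
          Integrable.coeFn_toL1 (hint j j.2)] with u h3 h4
        rw [h3, Pi.smul_apply, h4, smul_eq_mul]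
      filter_upwards [ae_all_iff.2 this] with u hu
      simp [hu]
    rw [h2]
    exact Integrable.coeFn_toL1 _
  have hker : LinearMap.ker L = ⊥ := by
    refine LinearMap.ker_eq_bot'.2 fun b hb => ?_
    refine coeff_eq_zero_of_ae_eq_zero hν hν0 b ?_
    have h0 := hL b
    rw [hb] at h0
    filter_upwards [h0, Lp.coeFn_zero ℝ 1 ν] with u h1 h2
    rw [← h1, h2, Pi.zero_apply]
  obtain ⟨Kc, hKc, hA⟩ := L.exists_antilipschitzWith hker
  refine ⟨(Kc : ℝ)⁻¹, by positivity, fun b => ?_⟩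
  have h1 := hA.le_mul_dist (fun j : Fin k => b j) 0
  rw [map_zero, dist_zero_right, dist_zero_right, L1.norm_eq_integral_norm] at h1
  have hnorm : ∫ u, ‖L (fun j : Fin k => b j) u‖ ∂ν =
      ∫ u, ‖∑ j : Fin k, b j * u ^ (j : ℕ)‖ ∂ν :=
    integral_congr_ae ((hL _).fun_comp (fun v => ‖v‖))
  rw [hnorm] at h1
  have h2 : |b 0| ≤ ‖fun j : Fin k => b j‖ := norm_le_pi_norm (fun j : Fin k => b j) ⟨0, hk⟩
  rw [inv_mul_le_iff₀ (by exact_mod_cast hKc)]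
  refine h2.trans (h1.trans (le_of_eq ?_))
  congr 1
  refine integral_congr_ae (.of_forall fun u => ?_)
  simp only [Real.norm_eq_abs]
  rw [Fin.sum_univ_eq_sum_range (fun j => b j * u ^ j)]

/-- For a nonnegative function with uniformly controlled Taylor remainders, the value at a point is
bounded, up to the remainder, by averages around that point at every scale. -/
theorem exists_mul_le_integral_add (hν : ν ≪ volume) (hν0 : ν ≠ 0) [IsFiniteMeasure ν]
    {k : ℕ} (hk : 1 ≤ k) (hint : ∀ j ≤ k, Integrable (fun u : ℝ => u ^ j) ν)
    {f : ℝ → ℝ} (hf : ∀ y, 0 ≤ f y) {a : ℝ → ℕ → ℝ} {C : ℝ} (ha : ∀ y, a y 0 = f y)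
    (hT : ∀ y t, |f (y + t) - ∑ j ∈ Finset.range k, a y j * t ^ j| ≤ C * |t| ^ k)
    (hfint : ∀ y h, Integrable (fun u => f (y + h * u)) ν) :
    ∃ c : ℝ, 0 < c ∧ ∃ C' : ℝ, ∀ y h, 0 ≤ h →
      c * f y ≤ ∫ u, f (y + h * u) ∂ν + C' * h ^ k := by
  obtain ⟨c, hc, hcb⟩ := exists_abs_coeff_zero_le_integral hν hν0 hk (fun j hj => hint j hj.le)
  refine ⟨c, hc, C * ∫ u, |u| ^ k ∂ν, fun y h hh => ?_⟩
  have hik : Integrable (fun u : ℝ => |u| ^ k) ν := by simpa using (hint k le_rfl).abs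
  -- The scale `h` is absorbed into the coefficients and leaves the constant term unchanged, so `c`
  -- does not depend on `h`.
  have h1 := hcb (fun j => a y j * h ^ j)
  simp only [pow_zero, mul_one, ha, abs_of_nonneg (hf y)] at h1
  refine h1.trans ?_
  calc ∫ u, |∑ j ∈ Finset.range k, a y j * h ^ j * u ^ j| ∂ν
      ≤ ∫ u, (f (y + h * u) + C * h ^ k * |u| ^ k) ∂ν := by
        refine integral_mono ?_ ((hfint y h).add (hik.const_mul _)) fun u => ?_
        · exact (integrable_finsetSum _ fun j hj =>
            (hint j (Finset.mem_range.1 hj).le).const_mul _).abs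
        · have h2 := hT y (h * u)
          have h3 : ∑ j ∈ Finset.range k, a y j * (h * u) ^ j =
              ∑ j ∈ Finset.range k, a y j * h ^ j * u ^ j :=
            Finset.sum_congr rfl fun j _ => by rw [mul_pow, mul_assoc]
          rw [h3, abs_mul, abs_of_nonneg hh, mul_pow, ← mul_assoc] at h2
          have h4 := hf (y + h * u)
          -- The absolute value of the polynomial exceeds |f| by at most the remainder, and |f| = f:
          -- this is where nonnegativity enters.
          have h5 := abs_sub_abs_le_abs_sub (∑ j ∈ Finset.range k, a y j * h ^ j * u ^ j)
            (f (y + h * u))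
          rw [abs_sub_comm, abs_of_nonneg h4] at h5
          simp only
          linarith
    _ = _ := by
        rw [integral_add (hfint y h) (hik.const_mul _), integral_const_mul]
        ring

end NormEquivalence

/-! ### Integration against a density; boundedness of the density -/

section Density

variable {f : ℝ → ℝ} {P : Measure ℝ}

theorem IsDensityOf.integral_eq (hf : IsDensityOf f P) (g : ℝ → ℝ) :
    ∫ t, g t ∂P = ∫ t, g t * f t := by
  rw [hf.eq_withDensity, integral_withDensity_eq_integral_toReal_smul
    hf.measurable.ennreal_ofReal (by simp)]
  refine integral_congr_ae (.of_forall fun t => ?_)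
  simp only [smul_eq_mul]
  rw [ENNReal.toReal_ofReal (hf.nonneg t), mul_comm]

theorem IsDensityOf.integrable_iff (hf : IsDensityOf f P) (g : ℝ → ℝ) :
    Integrable g P ↔ Integrable (fun t => g t * f t) := by
  rw [hf.eq_withDensity, integrable_withDensity_iff hf.measurable.ennreal_ofReal (by simp)]
  simp only [ENNReal.toReal_ofReal (hf.nonneg _)]

theorem IsDensityOf.integrable [IsProbabilityMeasure P] (hf : IsDensityOf f P) : Integrable f := by
  simpa using (hf.integrable_iff (fun _ => (1 : ℝ))).1 (integrable_const _)

theorem IsDensityOf.integral_eq_one [IsProbabilityMeasure P] (hf : IsDensityOf f P) :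
    ∫ t, f t = 1 := by
  have := hf.integral_eq (fun _ => (1 : ℝ))
  simpa using this.symm

theorem IsDensityOf.ae_pos (hf : IsDensityOf f P) : ∀ᵐ y ∂P, 0 < f y := by
  rw [hf.eq_withDensity, ae_withDensity_iff hf.measurable.ennreal_ofReal]
  refine .of_forall fun y hy => ?_
  simpa using hy

/-- A probability density with uniformly controlled Taylor remainders is bounded. -/
theorem IsDensityOf.exists_bound [IsProbabilityMeasure P] (hf : IsDensityOf f P)
    (hfc : Continuous f) {k : ℕ} (hk : 1 ≤ k) {a : ℝ → ℕ → ℝ} {C : ℝ} (ha : ∀ y, a y 0 = f y)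
    (hT : ∀ y t, |f (y + t) - ∑ j ∈ Finset.range k, a y j * t ^ j| ≤ C * |t| ^ k) :
    ∃ S : ℝ, 0 < S ∧ ∀ y, f y ≤ S := by
  have hne : volume.restrict (Set.Icc (-1 : ℝ) 1) ≠ 0 := by
    rw [Ne, Measure.restrict_eq_zero, Real.volume_Icc]
    norm_num
  have hcont : ∀ g : ℝ → ℝ, Continuous g →
      Integrable g (volume.restrict (Set.Icc (-1 : ℝ) 1)) := fun g hg =>
    hg.continuousOn.integrableOn_compact isCompact_Icc
  obtain ⟨c, hc, C', h⟩ := exists_mul_le_integral_add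
    (Measure.absolutelyContinuous_of_le Measure.restrict_le_self) hne hk
    (fun j _ => hcont _ (by fun_prop)) hf.nonneg ha hT (fun y h => hcont _ (by fun_prop))
  -- The scale is fixed at 1: the average of `f` over the window around `y` is at most its total
  -- mass 1.
  refine ⟨(1 + |C'|) / c, by positivity, fun y => ?_⟩
  rw [le_div_iff₀ hc, mul_comm]
  refine (h y 1 zero_le_one).trans ?_
  have h1 : ∫ u in Set.Icc (-1 : ℝ) 1, f (y + 1 * u) ≤ 1 := by
    simp only [one_mul]
    calc ∫ u in Set.Icc (-1 : ℝ) 1, f (y + u) ≤ ∫ u, f (y + u) :=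
          setIntegral_le_integral (hf.integrable.comp_add_left y) (.of_forall fun u => hf.nonneg _)
      _ = 1 := by rw [integral_add_left_eq_self f y, hf.integral_eq_one]
  simpa using add_le_add h1 (le_abs_self _)

/-- Change of variables for the expectation of a rescaled kernel. -/
theorem IsDensityOf.integral_comp_sub_div (hf : IsDensityOf f P) (G : ℝ → ℝ) (y : ℝ) {h : ℝ}
    (hh : 0 < h) : ∫ t, G ((t - y) / h) ∂P = h * ∫ u, G u * f (y + h * u) := by
  rw [hf.integral_eq]
  have h1 := Measure.integral_comp_mul_left (fun v => G (v / h) * f (y + v)) h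
  have h2 := integral_sub_right_eq_self (μ := volume) (fun v => G (v / h) * f (y + v)) y
  simp only [add_sub_cancel, mul_div_cancel_left₀ _ hh.ne'] at h1 h2
  rw [h2, h1, abs_of_pos (inv_pos.2 hh), smul_eq_mul, ← mul_assoc, mul_inv_cancel₀ hh.ne', one_mul]

end Density

/-! ### Smoothed density: limit and lower bound -/

section Kernel

variable {f K : ℝ → ℝ} {P : Measure ℝ} {k : ℕ}

theorem integrable_mul_comp_affine (hK : Integrable K) (hfc : Continuous f) {S : ℝ}
    (hS : ∀ y, |f y| ≤ S) (y h : ℝ) : Integrable (fun u => K u * f (y + h * u)) :=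
  hK.mul_bdd (c := S) (by fun_prop) (.of_forall fun u => hS _)

theorem tendsto_integral_mul_comp_affine (hK : Integrable K) (hK1 : ∫ u, K u = 1)
    (hfc : Continuous f) {S : ℝ} (hS : ∀ y, |f y| ≤ S) {h : ℕ → ℝ} (hh : Tendsto h atTop (𝓝 0))
    (y : ℝ) : Tendsto (fun n => ∫ u, K u * f (y + h n * u)) atTop (𝓝 (f y)) := by
  have h1 : f y = ∫ u, K u * f y := by rw [integral_mul_const, hK1, one_mul]
  rw [h1]
  refine tendsto_integral_of_dominated_convergence (fun u => |K u| * S)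
    (fun n => (integrable_mul_comp_affine hK hfc hS y (h n)).aestronglyMeasurable)
    (hK.abs.mul_const S) (fun n => .of_forall fun u => ?_) (.of_forall fun u => ?_)
  · rw [Real.norm_eq_abs, abs_mul]
    gcongr
    exact hS _
  · refine Tendsto.const_mul _ (hfc.continuousAt.tendsto.comp ?_)
    simpa using (hh.mul_const u).const_add y

theorem HasOrder.integrable_pow_mul (hK : Integrable K) (ho : HasOrder k K) {j : ℕ} (hj : j ≤ k) :
    Integrable (fun u => u ^ j * K u) := by
  refine (hK.abs.add ho.1.abs).mono' ?_ (.of_forall fun u => ?_)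
  · exact (by fun_prop : AEStronglyMeasurable (fun u : ℝ => u ^ j)).mul hK.aestronglyMeasurable
  · simp only [Pi.add_apply, Real.norm_eq_abs, abs_mul, abs_pow]
    have : |u| ^ j ≤ 1 + |u| ^ k := by
      rcases le_total |u| 1 with h | h
      · exact (pow_le_one₀ (abs_nonneg _) h).trans (by simp)
      · exact (pow_le_pow_right₀ h hj).trans (by simp)
    nlinarith [abs_nonneg (K u)]

/-- Lower bound of the smoothed density in terms of the density, for a kernel of order `k`. -/
theorem exists_mul_le_smoothed_of_hasOrder (hK : Integrable K) (hK1 : ∫ u, K u = 1)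
    (ho : HasOrder k K) (hk : 1 ≤ k) (hfc : Continuous f) {S : ℝ} (hS : ∀ y, |f y| ≤ S)
    {a : ℝ → ℕ → ℝ} {C : ℝ} (ha : ∀ y, a y 0 = f y)
    (hT : ∀ y t, |f (y + t) - ∑ j ∈ Finset.range k, a y j * t ^ j| ≤ C * |t| ^ k) :
    ∃ c : ℝ, 0 < c ∧ ∃ C' : ℝ, ∀ y h, 0 ≤ h →
      c * f y ≤ (∫ u, K u * f (y + h * u)) + C' * h ^ k := by
  refine ⟨1, one_pos, C * ∫ u, |u ^ k * K u|, fun y h hh => ?_⟩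
  have hi := integrable_mul_comp_affine hK hfc hS y h
  have hj : ∀ j ∈ Finset.range k, Integrable (fun u => a y j * h ^ j * (u ^ j * K u)) :=
    fun j hj => (ho.integrable_pow_mul hK (Finset.mem_range.1 hj).le).const_mul _
  -- The vanishing moments remove every Taylor term except the constant one.
  have hpoly : ∫ u, ∑ j ∈ Finset.range k, a y j * h ^ j * (u ^ j * K u) = f y := by
    rw [integral_finsetSum _ hj, Finset.sum_eq_single 0]
    · rw [integral_const_mul]
      simp [hK1, ha]
    · intro j hjk hj0
      rw [integral_const_mul, ho.2 j (Nat.one_le_iff_ne_zero.2 hj0) (Finset.mem_range.1 hjk),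
        mul_zero]
    · intro h0
      exact absurd (Finset.mem_range.2 hk) h0
  have hdiff : |∫ u, (K u * f (y + h * u) -
      ∑ j ∈ Finset.range k, a y j * h ^ j * (u ^ j * K u))| ≤
      ∫ u, C * h ^ k * |u ^ k * K u| := by
    rw [← Real.norm_eq_abs]
    refine norm_integral_le_of_norm_le (ho.1.abs.const_mul _) (.of_forall fun u => ?_)
    have h1 := hT y (h * u)
    have h2 : K u * f (y + h * u) - ∑ j ∈ Finset.range k, a y j * h ^ j * (u ^ j * K u) =
        K u * (f (y + h * u) - ∑ j ∈ Finset.range k, a y j * (h * u) ^ j) := by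
      rw [mul_sub, Finset.mul_sum]
      congr 1
      exact Finset.sum_congr rfl fun j _ => by ring
    rw [h2, Real.norm_eq_abs, abs_mul]
    calc |K u| * _ ≤ |K u| * (C * |h * u| ^ k) := by gcongr
      _ = _ := by
        rw [abs_mul, abs_of_nonneg hh, abs_mul, abs_pow]
        ring
  rw [integral_sub hi (integrable_finsetSum _ hj), hpoly, integral_const_mul] at hdiff
  have := (abs_le.1 hdiff).1
  rw [one_mul, mul_right_comm]
  linarith

/-- Lower bound of the smoothed density in terms of the density, for a nonnegative kernel. -/
theorem exists_mul_le_smoothed_of_nonneg (hK : Integrable K) (hK1 : ∫ u, K u = 1)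
    (hKm : Measurable K) (hK0 : ∀ u, 0 ≤ K u) (hk : 1 ≤ k) (hf : ∀ y, 0 ≤ f y)
    (hfc : Continuous f) {S : ℝ} (hS : ∀ y, |f y| ≤ S)
    {a : ℝ → ℕ → ℝ} {C : ℝ} (ha : ∀ y, a y 0 = f y)
    (hT : ∀ y t, |f (y + t) - ∑ j ∈ Finset.range k, a y j * t ^ j| ≤ C * |t| ^ k) :
    ∃ c : ℝ, 0 < c ∧ ∃ C' : ℝ, ∀ y h, 0 ≤ h →
      c * f y ≤ (∫ u, K u * f (y + h * u)) + C' * h ^ k := by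
  let κ : Measure ℝ := volume.withDensity fun u => ENNReal.ofReal (K u)
  have hκ : IsDensityOf K κ := ⟨hKm, hK0, rfl⟩
  have hκ1 : κ Set.univ = 1 := by
    simp only [κ, withDensity_apply _ MeasurableSet.univ, Measure.restrict_univ]
    rw [← ofReal_integral_eq_lintegral_ofReal hK (.of_forall hK0), hK1, ENNReal.ofReal_one]
  have : IsProbabilityMeasure κ := ⟨hκ1⟩
  -- A nonnegative kernel need not have finite moments; truncating it to a compact interval of
  -- positive mass makes all of them finite. Since `f ≥ 0`, the discarded part can only help the
  -- lower bound.
  obtain ⟨A, hA⟩ : ∃ A : ℕ, κ (Set.Icc (-(A : ℝ)) A) ≠ 0 := by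
    by_contra! hall
    have hun : (⋃ A : ℕ, Set.Icc (-(A : ℝ)) A) = Set.univ := by
      refine Set.eq_univ_of_forall fun u => ?_
      obtain ⟨A, hA⟩ := exists_nat_ge |u|
      exact Set.mem_iUnion.2 ⟨A, abs_le.1 hA⟩
    have := measure_iUnion_null hall
    rw [hun, hκ1] at this
    exact one_ne_zero this
  have hle : κ.restrict (Set.Icc (-(A : ℝ)) A) ≤ κ := Measure.restrict_le_self
  have hac : κ.restrict (Set.Icc (-(A : ℝ)) A) ≪ volume :=
    (Measure.absolutelyContinuous_of_le hle).trans (withDensity_absolutelyContinuous _ _)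
  have hcont : ∀ g : ℝ → ℝ, Continuous g →
      Integrable g (κ.restrict (Set.Icc (-(A : ℝ)) A)) := fun g hg =>
    hg.continuousOn.integrableOn_compact isCompact_Icc
  obtain ⟨c, hc, C', h⟩ := exists_mul_le_integral_add hac
    (by rwa [Ne, Measure.restrict_eq_zero]) hk (fun j _ => hcont _ (by fun_prop)) hf ha hT
    (fun y h => hcont _ (by fun_prop))
  refine ⟨c, hc, C', fun y h' hh => (h y h' hh).trans ?_⟩
  refine add_le_add ?_ le_rfl
  calc ∫ u in Set.Icc (-(A : ℝ)) A, f (y + h' * u) ∂κ ≤ ∫ u, f (y + h' * u) ∂κ := by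
        refine setIntegral_le_integral ?_ (.of_forall fun u => hf _)
        rw [hκ.integrable_iff]
        simpa only [mul_comm] using integrable_mul_comp_affine hK hfc hS y h'
    _ = _ := by
        rw [hκ.integral_eq]
        simp only [mul_comm]

/-- Lower bound of the smoothed density in terms of the density, for a classical kernel. -/
theorem IsClassicalKernel.exists_mul_le_smoothed (hK : IsClassicalKernel k K) (hk : 1 ≤ k)
    (hf : ∀ y, 0 ≤ f y) (hfc : Continuous f) {S : ℝ} (hS : ∀ y, |f y| ≤ S)
    {a : ℝ → ℕ → ℝ} {C : ℝ} (ha : ∀ y, a y 0 = f y)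
    (hT : ∀ y t, |f (y + t) - ∑ j ∈ Finset.range k, a y j * t ^ j| ≤ C * |t| ^ k) :
    ∃ c : ℝ, 0 < c ∧ ∃ C' : ℝ, ∀ y h, 0 ≤ h →
      c * f y ≤ (∫ u, K u * f (y + h * u)) + C' * h ^ k :=
  hK.nonneg_or_order.elim
    (fun h0 => exists_mul_le_smoothed_of_nonneg hK.integrable hK.integral_eq_one hK.measurable h0
      hk hf hfc hS ha hT)
    (fun ho => exists_mul_le_smoothed_of_hasOrder hK.integrable hK.integral_eq_one ho hk hfc hS
      ha hT)

/-- The second moment of a rescaled bounded integrable kernel is of the order of the bandwidth. -/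
theorem IsDensityOf.integral_sq_comp_sub_div_le (hf : IsDensityOf f P)
    {S : ℝ} (hS : ∀ y, |f y| ≤ S) (hK : Integrable K) {B : ℝ} (hB : ∀ u, |K u| ≤ B) (y : ℝ)
    {h : ℝ} (hh : 0 < h) :
    ∫ t, K ((t - y) / h) ^ 2 ∂P ≤ B * S * (∫ u, |K u|) * h := by
  rw [hf.integral_comp_sub_div (fun u => K u ^ 2) y hh, mul_comm]
  gcongr
  rw [← integral_const_mul]
  refine integral_mono_of_nonneg (.of_forall fun u => by have := hf.nonneg (y + h * u); positivity)
    (hK.abs.const_mul _) (.of_forall fun u => ?_)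
  have h1 : f (y + h * u) ≤ S := (le_abs_self _).trans (hS _)
  have hB0 : 0 ≤ B := (abs_nonneg _).trans (hB 0)
  simp only
  calc K u ^ 2 * f (y + h * u) = |K u| * |K u| * f (y + h * u) := by rw [abs_mul_abs_self, sq]
    _ ≤ B * |K u| * S := by
        gcongr
        · exact hf.nonneg _
        · exact hB u
    _ = _ := by ring

end Kernel

/-! ### Relative error of a trimmed random denominator -/

section Ratio

/-- Divide c F ≤ z + |z − m| + D e by max z e, which dominates both z and e. This is the crude
bound, valid even where m is below the trimming level. -/
theorem abs_div_max_sub_one_le_of_mul_le {F m z e c D : ℝ} (hF : 0 ≤ F) (he : 0 < e) (hc : 0 < c)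
    (hD : 0 ≤ D) (hcF : c * F ≤ m + D * e) :
    |F / max z e - 1| ≤ (|z - m| / e + 1 + D) / c + 1 := by
  have hM : 0 < max z e := lt_max_of_lt_right he
  have h1 : F / max z e ≤ (|z - m| / e + 1 + D) / c := by
    rw [le_div_iff₀ hc, div_mul_eq_mul_div, div_le_iff₀ hM]
    have h2 : |z - m| ≤ |z - m| / e * max z e := by
      rw [div_mul_eq_mul_div, le_div_iff₀ he]
      gcongr
      exact le_max_right _ _
    have h3 : D * e ≤ D * max z e := by
      gcongr
      exact le_max_right _ _
    have h4 := le_max_left z e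
    have h5 := neg_abs_le (z - m)
    nlinarith
  have h0 : 0 ≤ F / max z e := by positivity
  rw [abs_le]
  constructor <;> linarith

/-- When e ≤ m, trimming fixes m and is 1-Lipschitz, so M = max z e is at least as close to m as z
is. Expanding m/M − 1 = (m − M)/m + (m − M)²/(m M) puts the random denominator, bounded below only
by e, under a square: a mean square error of order e² then costs only O(e/m). -/
theorem abs_div_max_sub_one_le_of_le {F m z e : ℝ} (hF : 0 ≤ F) (he : 0 < e) (hem : e ≤ m) :
    |F / max z e - 1| ≤ F / m * (|z - m| / m + (z - m) ^ 2 / (m * e)) + |F / m - 1| := by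
  have hM : 0 < max z e := lt_max_of_lt_right he
  have hm : 0 < m := he.trans_le hem
  have hd : |m - max z e| ≤ |z - m| := by
    have := abs_max_sub_max_le_abs z m e
    rwa [max_eq_left hem, abs_sub_comm] at this
  have h1 : |m / max z e - 1| ≤ |z - m| / m + (z - m) ^ 2 / (m * e) := by
    have h2 : m / max z e - 1 = (m - max z e) / m + (m - max z e) ^ 2 / (m * max z e) := by
      field_simp
      ring
    rw [h2]
    refine (abs_add_le _ _).trans ?_
    rw [abs_div, abs_of_pos hm, abs_div, abs_of_pos (mul_pos hm hM), abs_sq]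
    gcongr ?_ / m + ?_ / (m * ?_)
    · exact sq_le_sq.2 hd
    · exact le_max_right _ _
  have h3 : F / max z e - 1 = F / m * (m / max z e - 1) + (F / m - 1) := by
    field_simp
    ring
  rw [h3]
  refine (abs_add_le _ _).trans ?_
  rw [abs_mul, abs_of_nonneg (by positivity : 0 ≤ F / m)]
  gcongr

/-- Upper bound for the mean relative error `|F / max W e - 1|`, in terms of a deterministic
approximation `m` of `W` whose mean square error is at most `V * e ^ 2`. -/
noncomputable def ratioBound (V c D F m e : ℝ) : ℝ :=
  if e ≤ m then min ((V + 2 + D) / c + 1) (F / m * ((2 * V + 1) * e / m) + |F / m - 1|)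
  else (V + 2 + D) / c + 1

variable {V c D F m e : ℝ}

theorem ratioBound_nonneg (hV : 0 ≤ V) (hc : 0 < c) (hD : 0 ≤ D) (hF : 0 ≤ F) (he : 0 < e) :
    0 ≤ ratioBound V c D F m e := by
  unfold ratioBound
  split_ifs with h
  · have : 0 < m := he.trans_le h
    positivity
  · positivity

theorem ratioBound_le : ratioBound V c D F m e ≤ (V + 2 + D) / c + 1 := by
  unfold ratioBound
  split_ifs
  · exact min_le_left _ _
  · exact le_rfl

theorem measurable_ratioBound {α : Type*} [MeasurableSpace α] {F m : α → ℝ} (hF : Measurable F)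
    (hm : Measurable m) : Measurable fun y => ratioBound V c D (F y) (m y) e := by
  unfold ratioBound
  refine Measurable.ite (measurableSet_le measurable_const hm) ?_ measurable_const
  fun_prop

theorem tendsto_ratioBound (hV : 0 ≤ V) (hc : 0 < c) (hD : 0 ≤ D) (hF : 0 < F) {m e : ℕ → ℝ}
    (hm : Tendsto m atTop (𝓝 F)) (he : Tendsto e atTop (𝓝 0)) (hepos : ∀ᶠ n in atTop, 0 < e n) :
    Tendsto (fun n => ratioBound V c D F (m n) (e n)) atTop (𝓝 0) := by
  have h1 : Tendsto (fun n => F / m n * ((2 * V + 1) * e n / m n) + |F / m n - 1|) atTop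
      (𝓝 (F / F * ((2 * V + 1) * 0 / F) + |F / F - 1|)) :=
    ((tendsto_const_nhds.div hm hF.ne').mul ((he.const_mul _).div hm hF.ne')).add
      ((tendsto_const_nhds.div hm hF.ne').sub_const 1).abs
  rw [div_self hF.ne'] at h1
  simp only [mul_zero, zero_div, sub_self, abs_zero, add_zero] at h1
  have h2 : ∀ᶠ n in atTop, e n ≤ m n := by
    filter_upwards [he.eventually_lt hm hF] with n hn using hn.le
  refine squeeze_zero' ?_ ?_ h1
  · filter_upwards [hepos] with n hn using ratioBound_nonneg hV hc hD hF.le hn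
  · filter_upwards [h2] with n hn
    rw [ratioBound, if_pos hn]
    exact min_le_right _ _

variable {Ω : Type*} [MeasurableSpace Ω] {μ : Measure Ω} [IsProbabilityMeasure μ]

/-- Both pointwise bounds are averaged. From |x| ≤ x²/e + e the mean absolute deviation is at most
(V + 1) e; this produces V + 2 + D in the crude bound and 2V + 1 = (V + 1) + V in the fine one. -/
theorem lintegral_abs_div_max_sub_one_le {W : Ω → ℝ} (hW1 : Integrable (fun ω => W ω - m) μ)
    (hW2 : Integrable (fun ω => (W ω - m) ^ 2) μ) (hV : ∫ ω, (W ω - m) ^ 2 ∂μ ≤ V * e ^ 2)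
    (hF : 0 ≤ F) (he : 0 < e) (hc : 0 < c) (hD : 0 ≤ D) (hcF : c * F ≤ m + D * e) :
    ∫⁻ ω, ENNReal.ofReal |F / max (W ω) e - 1| ∂μ ≤ ENNReal.ofReal (ratioBound V c D F m e) := by
  have hmean : ∫ ω, |W ω - m| ∂μ ≤ (V + 1) * e := by
    calc ∫ ω, |W ω - m| ∂μ ≤ ∫ ω, ((W ω - m) ^ 2 / e + e) ∂μ := by
          refine integral_mono hW1.abs ((hW2.div_const e).add (integrable_const e)) fun ω => ?_
          have h1 : |W ω - m| * e ≤ (W ω - m) ^ 2 + e ^ 2 := by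
            rw [← sq_abs]
            nlinarith [sq_nonneg (|W ω - m| - e), sq_nonneg (|W ω - m| + e)]
          have h2 : (W ω - m) ^ 2 / e + e = ((W ω - m) ^ 2 + e ^ 2) / e := by field_simp
          simp only
          rw [h2, le_div_iff₀ he]
          exact h1
      _ = (∫ ω, (W ω - m) ^ 2 ∂μ) / e + e := by
          rw [integral_add (hW2.div_const e) (integrable_const e), integral_div]
          simp
      _ ≤ V * e ^ 2 / e + e := by gcongr
      _ = (V + 1) * e := by field_simp
  have hup : ∀ {G : Ω → ℝ}, Integrable G μ → (∀ ω, |F / max (W ω) e - 1| ≤ G ω) →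
      ∀ b, ∫ ω, G ω ∂μ ≤ b → ∫⁻ ω, ENNReal.ofReal |F / max (W ω) e - 1| ∂μ ≤ ENNReal.ofReal b := by
    intro G hG hle b hb
    refine (lintegral_mono fun ω => ENNReal.ofReal_le_ofReal (hle ω)).trans ?_
    rw [← ofReal_integral_eq_lintegral_ofReal hG
      (.of_forall fun ω => (abs_nonneg _).trans (hle ω))]
    exact ENNReal.ofReal_le_ofReal hb
  have hA : ∫⁻ ω, ENNReal.ofReal |F / max (W ω) e - 1| ∂μ ≤
      ENNReal.ofReal ((V + 2 + D) / c + 1) := by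
    have hi : Integrable (fun ω => |W ω - m| / e + 1 + D) μ :=
      ((hW1.abs.div_const e).add (integrable_const 1)).add (integrable_const D)
    refine hup (G := fun ω => (|W ω - m| / e + 1 + D) / c + 1)
      ((hi.div_const c).add (integrable_const 1))
      (fun ω => abs_div_max_sub_one_le_of_mul_le hF he hc hD hcF) _ ?_
    rw [integral_add (hi.div_const c) (integrable_const 1), integral_div,
      integral_add (f := fun ω => |W ω - m| / e + 1)
        ((hW1.abs.div_const e).add (integrable_const 1)) (integrable_const D),
      integral_add (hW1.abs.div_const e) (integrable_const 1), integral_div]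
    simp only [integral_const, probReal_univ, one_smul]
    gcongr ?_ / c + 1
    have : (∫ ω, |W ω - m| ∂μ) / e ≤ V + 1 := by rwa [div_le_iff₀ he]
    linarith
  unfold ratioBound
  split_ifs with hem
  · rw [ENNReal.ofReal_min]
    refine le_min hA ?_
    have hm : 0 < m := he.trans_le hem
    have hi : Integrable (fun ω => |W ω - m| / m + (W ω - m) ^ 2 / (m * e)) μ :=
      (hW1.abs.div_const m).add (hW2.div_const (m * e))
    refine hup (G := fun ω => F / m * (|W ω - m| / m + (W ω - m) ^ 2 / (m * e)) + |F / m - 1|)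
      ((hi.const_mul (F / m)).add (integrable_const |F / m - 1|))
      (fun ω => abs_div_max_sub_one_le_of_le hF he hem) _ ?_
    rw [integral_add (hi.const_mul (F / m)) (integrable_const _), integral_const_mul,
      integral_add (hW1.abs.div_const m) (hW2.div_const (m * e)), integral_div, integral_div]
    simp only [integral_const, probReal_univ, one_smul]
    gcongr
    calc (∫ ω, |W ω - m| ∂μ) / m + (∫ ω, (W ω - m) ^ 2 ∂μ) / (m * e)
        ≤ (V + 1) * e / m + V * e ^ 2 / (m * e) := by gcongr
      _ = (2 * V + 1) * e / m := by
        field_simp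
        ring
  · exact hA

end Ratio

/-! ### Variance of iid sums and conditioning on one variable -/

section Sample

variable {Ω : Type*} [MeasurableSpace Ω] {μ : Measure Ω} [IsProbabilityMeasure μ]
  {P : Measure ℝ} {X : ℕ → Ω → ℝ}

/-- Bound on the mean square deviation of a sum of bounded functions of iid variables. -/
theorem integral_sq_sum_sub_le (hXm : ∀ i, Measurable (X i)) (hXind : iIndepFun X μ)
    (hXlaw : ∀ i, μ.map (X i) = P) {g : ℝ → ℝ} (hg : Measurable g) {B : ℝ} (hB : ∀ t, |g t| ≤ B)
    (s : Finset ℕ) :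
    ∫ ω, (∑ j ∈ s, g (X j ω) - s.card * ∫ t, g t ∂P) ^ 2 ∂μ ≤ s.card * ∫ t, g t ^ 2 ∂P := by
  have hm : ∀ j, MemLp (fun ω => g (X j ω)) 2 μ := fun j =>
    MemLp.of_bound (hg.comp (hXm j)).aestronglyMeasurable B (.of_forall fun ω => hB _)
  have hmean : ∀ j, ∫ ω, g (X j ω) ∂μ = ∫ t, g t ∂P := fun j => by
    rw [← hXlaw j, integral_map (hXm j).aemeasurable hg.aestronglyMeasurable]
  have hsq : ∀ j, ∫ ω, g (X j ω) ^ 2 ∂μ = ∫ t, g t ^ 2 ∂P := fun j => by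
    rw [← hXlaw j, integral_map (hXm j).aemeasurable (hg.pow_const 2).aestronglyMeasurable]
  have hvar := IndepFun.variance_sum (s := s) (X := fun j ω => g (X j ω)) (μ := μ)
    (fun j _ => hm j) (fun i _ j _ hij => (hXind.indepFun hij).comp hg hg)
  have hexp : ∫ ω, (∑ j ∈ s, fun ω => g (X j ω)) ω ∂μ = s.card * ∫ t, g t ∂P := by
    simp only [Finset.sum_apply]
    rw [integral_finsetSum _ fun j _ => (hm j).integrable (by norm_num)]
    simp [hmean]
  have hmeas : Measurable (∑ j ∈ s, fun ω => g (X j ω)) := by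
    rw [Finset.sum_fn]
    exact Finset.measurable_sum s fun j _ => hg.comp (hXm j)
  rw [variance_eq_integral hmeas.aemeasurable, hexp] at hvar
  simp only [Finset.sum_apply] at hvar
  rw [hvar, ← nsmul_eq_mul]
  refine Finset.sum_le_card_nsmul _ _ _ fun j _ => ?_
  refine (variance_le_expectation_sq (hm j).aestronglyMeasurable).trans_eq ?_
  simpa using hsq j

/-- The expectation of a function of two independent variables as an iterated integral. -/
theorem lintegral_indepFun_eq {β : Type*} [MeasurableSpace β] {U : Ω → ℝ} {Y : Ω → β}
    (hU : Measurable U) (hY : Measurable Y) (hind : IndepFun U Y μ) {Φ : ℝ × β → ENNReal}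
    (hΦ : Measurable Φ) :
    ∫⁻ ω, Φ (U ω, Y ω) ∂μ = ∫⁻ y, ∫⁻ ω, Φ (y, Y ω) ∂μ ∂(μ.map U) := by
  have h1 := (indepFun_iff_map_prod_eq_prod_map_map hU.aemeasurable hY.aemeasurable).1 hind
  have := Measure.isProbabilityMeasure_map (μ := μ) hY.aemeasurable
  rw [← lintegral_map hΦ (hU.prodMk hY), h1, lintegral_prod _ hΦ.aemeasurable]
  refine lintegral_congr fun y => ?_
  rw [lintegral_map (by fun_prop) hY]

end Sample

/-! ### Consequences of the rate condition -/

section Rates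

variable {k : ℕ} {f : ℝ → ℝ} {h e : ℕ → ℝ}

theorem ConditionC.exists_rate_bounds (hC : ConditionC k f h e) (hh : ∀ n, 1 ≤ n → 0 < h n)
    (he : ∀ n, 1 ≤ n → 0 < e n) (he0 : Tendsto e atTop (𝓝 0)) :
    ∃ C : ℝ, 0 ≤ C ∧ ∀ᶠ n : ℕ in atTop, 2 ≤ n ∧ 0 < h n ∧ 0 < e n ∧ e n ≤ 1 ∧
      1 / (n * h n) ≤ C * e n ^ 2 ∧ h n ^ k ≤ C * e n ^ 2 := by
  obtain ⟨C, hC0, hCb⟩ := hC.rate.exists_nonneg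
  refine ⟨C, hC0, ?_⟩
  filter_upwards [hCb.bound, eventually_ge_atTop 3, he0.eventually_le_const one_pos]
    with n hn hn3 hn1
  have hhn := hh n (by omega)
  have hen := he n (by omega)
  have hn0 : (0 : ℝ) < n := by exact_mod_cast (by omega : 0 < n)
  -- Since e < 3 ≤ n, the logarithm is at least 1 and can be dropped.
  have hlog : 1 ≤ Real.log n := by
    rw [Real.le_log_iff_exp_le hn0]
    have h3 : (3 : ℝ) ≤ n := by exact_mod_cast hn3
    linarith [Real.exp_one_lt_d9]
  have h1 : 1 / (n * h n) ≤ Real.log n / (n * h n) := by gcongr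
  have h2 : 0 ≤ 1 / (n * h n) := by positivity
  have h3 : 0 ≤ h n ^ k := by positivity
  rw [Real.norm_of_nonneg (by positivity), Real.norm_of_nonneg (by positivity)] at hn
  exact ⟨by omega, hhn, hen, hn1, by linarith, by linarith⟩

theorem ConditionC.tendsto_bandwidth (hC : ConditionC k f h e) (hh : ∀ n, 1 ≤ n → 0 < h n)
    (he : ∀ n, 1 ≤ n → 0 < e n) (he0 : Tendsto e atTop (𝓝 0)) : Tendsto h atTop (𝓝 0) := by
  obtain ⟨C, hC0, hb⟩ := hC.exists_rate_bounds hh he he0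
  have h1 : Tendsto (fun n => h n ^ k) atTop (𝓝 0) := by
    refine squeeze_zero' ?_ ?_ (by simpa using (he0.pow 2).const_mul C)
    · filter_upwards [hb] with n hn
      have := hn.2.1
      positivity
    · filter_upwards [hb] with n hn using hn.2.2.2.2.2
  rw [Metric.tendsto_atTop'] at h1 ⊢
  intro ε hε
  obtain ⟨N, hN⟩ := h1 (ε ^ k) (by positivity)
  refine ⟨max N 1, fun n hn => ?_⟩
  have hhn := hh n (by omega)
  have h2 := hN n (by omega)
  rw [Real.dist_eq, sub_zero, abs_of_pos (by positivity)] at h2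
  rw [Real.dist_eq, sub_zero, abs_of_pos hhn]
  exact lt_of_pow_lt_pow_left₀ k hε.le h2

end Rates

/-! ### Kernel estimator at an observed point -/

/-- The mean of the kernel density estimator at `y` given that one of the `n` observations
equals `y`. -/
noncomputable def looMean (K f : ℝ → ℝ) (h : ℝ) (n : ℕ) (y : ℝ) : ℝ :=
  1 / (n * h) * (K 0 + (n - 1) * (h * ∫ u, K u * f (y + h * u)))

theorem looMean_eq (K f : ℝ → ℝ) {h : ℝ} (hh : h ≠ 0) {n : ℕ} (hn : n ≠ 0) (y : ℝ) :
    looMean K f h n y =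
      K 0 * (1 / (n * h)) + (1 - 1 / (n : ℝ)) * ∫ u, K u * f (y + h * u) := by
  have : (n : ℝ) ≠ 0 := by exact_mod_cast hn
  unfold looMean
  field_simp

theorem measurable_looMean {K f : ℝ → ℝ} (hK : Measurable K) (hf : Measurable f) (h : ℝ) (n : ℕ) :
    Measurable (looMean K f h n) := by
  unfold looMean
  have h1 : Measurable (fun p : ℝ × ℝ => K p.2 * f (p.1 + h * p.2)) := by fun_prop
  have h2 : Measurable fun y => ∫ u, K u * f (y + h * u) :=
    (h1.stronglyMeasurable.integral_prod_right (ν := volume)).measurable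
  fun_prop

section Estimator

variable {Ω : Type*} [MeasurableSpace Ω] {μ : Measure Ω} [IsProbabilityMeasure μ]
  {P : Measure ℝ} {X : ℕ → Ω → ℝ} {f K : ℝ → ℝ} {k : ℕ}

/-- Mean square error of the kernel density estimator at an observed value `y`. -/
theorem integral_sq_loo_sub_looMean_le (hXm : ∀ i, Measurable (X i)) (hXind : iIndepFun X μ)
    (hXlaw : ∀ i, μ.map (X i) = P) (hf : IsDensityOf f P) {S : ℝ} (hS : ∀ y, |f y| ≤ S)
    (hK : IsClassicalKernel k K) {B : ℝ} (hB : ∀ u, |K u| ≤ B) {h : ℝ} (hh : 0 < h) {n : ℕ}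
    (s : Finset ℕ) (hs : s.card + 1 = n) (y : ℝ) :
    ∫ ω, (1 / (n * h) * (K 0 + ∑ j ∈ s, K ((X j ω - y) / h)) - looMean K f h n y) ^ 2 ∂μ ≤
      B * S * (∫ u, |K u|) * (1 / (n * h)) := by
  have hn0 : (0 : ℝ) < n := by exact_mod_cast (by omega : 0 < n)
  have hcard : (s.card : ℝ) = n - 1 := by
    rw [← hs]
    simp
  have h1 := integral_sq_sum_sub_le hXm hXind hXlaw (g := fun t => K ((t - y) / h))
    (hK.measurable.comp (by fun_prop)) (fun t => hB _) s
  have h2 := hf.integral_sq_comp_sub_div_le hS hK.integrable hB y hh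
  rw [hf.integral_comp_sub_div K y hh, hcard] at h1
  have h3 : ∀ ω, (1 / (n * h) * (K 0 + ∑ j ∈ s, K ((X j ω - y) / h)) - looMean K f h n y) ^ 2 =
      (1 / (n * h)) ^ 2 *
        (∑ j ∈ s, K ((X j ω - y) / h) - (n - 1) * (h * ∫ u, K u * f (y + h * u))) ^ 2 :=
    fun ω => by
      unfold looMean
      ring
  simp only [h3]
  rw [integral_const_mul]
  have hi0 : 0 ≤ ∫ t, K ((t - y) / h) ^ 2 ∂P := integral_nonneg fun t => sq_nonneg _
  calc (1 / (n * h)) ^ 2 * _ ≤ (1 / (n * h)) ^ 2 * ((n - 1) * ∫ t, K ((t - y) / h) ^ 2 ∂P) := by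
        gcongr
    _ ≤ (1 / (n * h)) ^ 2 * (n * (B * S * (∫ u, |K u|) * h)) := by
        gcongr
        linarith
    _ = _ := by field_simp

/-- Under Condition (C), the relative error of the trimmed estimator at an observed value `y` is
bounded in mean by `ratioBound`, with constants that depend neither on `n` nor on `y`. -/
theorem exists_lintegral_relative_error_le [IsProbabilityMeasure P]
    (hXm : ∀ i, Measurable (X i)) (hXind : iIndepFun X μ)
    (hXlaw : ∀ i, μ.map (X i) = P) (hf : IsDensityOf f P) (hK : IsClassicalKernel k K)
    {h e : ℕ → ℝ} (hh : ∀ n, 1 ≤ n → 0 < h n) (he : ∀ n, 1 ≤ n → 0 < e n)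
    (he0 : Tendsto e atTop (𝓝 0)) (hC : ConditionC k f h e) :
    ∃ V c D : ℝ, 0 ≤ V ∧ 0 < c ∧ 0 ≤ D ∧
      (∀ y, Tendsto (fun n => looMean K f (h n) n y) atTop (𝓝 (f y))) ∧
      ∀ᶠ n : ℕ in atTop, ∀ (s : Finset ℕ), s.card + 1 = n → ∀ y,
        ∫⁻ ω, ENNReal.ofReal |f y /
            max (1 / (n * h n) * (K 0 + ∑ j ∈ s, K ((X j ω - y) / h n))) (e n) - 1| ∂μ ≤
          ENNReal.ofReal (ratioBound V c D (f y) (looMean K f (h n) n y) (e n)) := by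
  have hk := hC.one_le
  have hfc : Continuous f := hC.contDiff.continuous
  obtain ⟨M, hM⟩ := hC.bounded_deriv
  obtain ⟨a, C, -, ha, hT⟩ := exists_uniform_taylor_bound hk hC.contDiff hM
  obtain ⟨S, hS0, hS⟩ := hf.exists_bound hfc hk ha hT
  have hS' : ∀ y, |f y| ≤ S := fun y => by rw [abs_of_nonneg (hf.nonneg y)]; exact hS y
  obtain ⟨c, hc, C', hlow⟩ := hK.exists_mul_le_smoothed hk hf.nonneg hfc hS' ha hT
  obtain ⟨B, hB⟩ := hK.bounded
  have hB0 : 0 ≤ B := (abs_nonneg _).trans (hB 0)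
  obtain ⟨R, hR, hrate⟩ := hC.exists_rate_bounds hh he he0
  have hI : 0 ≤ ∫ u, |K u| := integral_nonneg fun u => abs_nonneg _
  -- The first constant is the variance bound times the rate constant. The factor 1 − 1/n ≥ 1/2
  -- halves `c`, and the third constant absorbs the self-term K(0)/(nh) and the bias C' h^k, using
  -- e² ≤ e.
  refine ⟨B * S * (∫ u, |K u|) * R, c / 2, (B + |C'|) * R, by positivity, by positivity,
    by positivity, fun y => ?_, ?_⟩
  · have h1 := tendsto_integral_mul_comp_affine hK.integrable hK.integral_eq_one hfc hS'
      (hC.tendsto_bandwidth hh he he0) y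
    have h2 : Tendsto (fun n : ℕ => 1 / (n * h n)) atTop (𝓝 0) := by
      refine squeeze_zero' ?_ ?_ (by simpa using (he0.pow 2).const_mul R)
      · filter_upwards [hrate] with n hn
        have := hn.2.1
        positivity
      · filter_upwards [hrate] with n hn using hn.2.2.2.2.1
    have h3 : Tendsto (fun n : ℕ => 1 - 1 / (n : ℝ)) atTop (𝓝 (1 - 0)) :=
      tendsto_one_div_atTop_nhds_zero_nat.const_sub 1
    have h4 := (h2.const_mul (K 0)).add (h3.mul h1)
    rw [mul_zero, sub_zero, one_mul, zero_add] at h4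
    refine h4.congr' ?_
    filter_upwards [hrate] with n hn
    rw [looMean_eq K f hn.2.1.ne' (by omega)]
  · filter_upwards [hrate] with n hn s hs y
    obtain ⟨hn2, hhn, hen, hen1, hr1, hr2⟩ := hn
    have hn0 : (0 : ℝ) < n := by exact_mod_cast (by omega : 0 < n)
    have hbd : ∀ ω, |1 / (n * h n) * (K 0 + ∑ j ∈ s, K ((X j ω - y) / h n)) -
        looMean K f (h n) n y| ≤
        1 / (n * h n) * (B + s.card * B) + |looMean K f (h n) n y| := fun ω => by
      refine (abs_sub _ _).trans ?_
      gcongr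
      rw [abs_mul, abs_of_pos (by positivity)]
      gcongr
      refine (abs_add_le _ _).trans ?_
      gcongr
      · exact hB 0
      · refine (Finset.abs_sum_le_sum_abs _ _).trans ?_
        rw [← nsmul_eq_mul]
        exact Finset.sum_le_card_nsmul _ _ _ fun j _ => hB _
    have hmeas : Measurable fun ω => 1 / (n * h n) * (K 0 + ∑ j ∈ s, K ((X j ω - y) / h n)) -
        looMean K f (h n) n y := by
      have : ∀ j, Measurable fun ω => K ((X j ω - y) / h n) := fun j =>
        hK.measurable.comp (((hXm j).sub_const y).div_const _)
      exact (((Finset.measurable_sum s fun j _ => this j).const_add _).const_mul _).sub_const _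
    refine lintegral_abs_div_max_sub_one_le
      (Integrable.of_bound hmeas.aestronglyMeasurable _ (.of_forall hbd))
      (Integrable.of_bound (hmeas.pow_const 2).aestronglyMeasurable
        ((1 / (n * h n) * (B + s.card * B) + |looMean K f (h n) n y|) ^ 2)
        (.of_forall fun ω => ?_)) ?_ (hf.nonneg y) hen (by positivity) (by positivity) ?_
    · rw [norm_pow]
      gcongr
      exact hbd ω
    · refine (integral_sq_loo_sub_looMean_le hXm hXind hXlaw hf hS' hK hB hhn s hs y).trans ?_
      rw [mul_assoc _ R]
      gcongr
    · rw [looMean_eq K f hhn.ne' (by omega)]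
      have h1 := hlow y (h n) hhn.le
      have hinv : 1 / (n : ℝ) ≤ 1 / 2 := by
        gcongr
        exact_mod_cast hn2
      have hinv0 : 0 ≤ 1 / (n : ℝ) := by positivity
      have h2 : C' * h n ^ k ≤ |C'| * R * e n := by
        calc C' * h n ^ k ≤ |C'| * (R * e n ^ 2) := by
              gcongr
              exact le_abs_self C'
          _ ≤ |C'| * (R * e n) := by
              gcongr
              nlinarith
          _ = _ := by ring
      have h3 : -(B * R * e n) ≤ K 0 * (1 / (n * h n)) := by
        have h4 : |K 0 * (1 / (n * h n))| ≤ B * (R * e n) := by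
          rw [abs_mul, abs_of_pos (by positivity : 0 < 1 / (n * h n))]
          gcongr
          · exact hB 0
          · refine hr1.trans ?_
            gcongr
            nlinarith
        have := neg_abs_le (K 0 * (1 / (n * h n)))
        linarith
      have h5 : 0 ≤ |C'| * R * e n := by positivity
      have h6 := hf.nonneg y
      have h7 : (1 - 1 / (n : ℝ)) * (c * f y) ≤
          (1 - 1 / (n : ℝ)) * ((∫ u, K u * f (y + h n * u)) + C' * h n ^ k) := by
        gcongr
        linarith
      have h8 : c / 2 * f y ≤ (1 - 1 / (n : ℝ)) * (c * f y) := by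
        have : 0 ≤ c * f y := by positivity
        nlinarith
      have h9 : (1 - 1 / (n : ℝ)) * (C' * h n ^ k) ≤ |C'| * R * e n := by
        calc _ ≤ (1 - 1 / (n : ℝ)) * (|C'| * R * e n) := by
              gcongr
              linarith
          _ ≤ _ := by nlinarith
      linarith

end Estimator

/-! ### Drawing weights and density ratios -/

section Weights

variable {f₀ K : ℝ → ℝ}

/-- The term `j = i` of the estimator is K(0); the rest depends on X_i only through the evaluation
point, which permits conditioning on X_i. The sum runs over a subtype so as to be a function of the
vector of other observations. -/
theorem weight_eq_loo (h e : ℝ) {n : ℕ} (x : ℕ → ℝ) (i : Fin n) :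
    weight f₀ K h e (fun j : Fin n => x j) i =
      f₀ (x i) / max (1 / (n * h) * (K 0 +
        ∑ j : {j // j ∈ (Finset.range n).erase i}, K ((x j - x i) / h))) e := by
  unfold weight trimmedKde kde
  rw [Fin.sum_univ_eq_sum_range (fun j => K ((x j - x i) / h)) n,
    Finset.sum_coe_sort ((Finset.range n).erase i) (fun j => K ((x j - x i) / h)),
    ← Finset.add_sum_erase _ _ (Finset.mem_range.2 i.2), sub_self, zero_div]

theorem weight_nonneg (hf₀ : ∀ y, 0 ≤ f₀ y) {h e : ℝ} (he : 0 < e) {n : ℕ} (s : Fin n → ℝ)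
    (i : Fin n) : 0 ≤ weight f₀ K h e s i :=
  div_nonneg (hf₀ _) (he.le.trans (le_max_right _ _))

theorem drawCdf_eq (hf₀ : ∀ y, 0 ≤ f₀ y) {h e : ℝ} (he : 0 < e) {n : ℕ} (s : Fin n → ℝ) (x : ℝ) :
    drawCdf f₀ K h e s x =
      (∑ i, (Set.Iic x).indicator 1 (s i) * weight f₀ K h e s i) / ∑ i, weight f₀ K h e s i := by
  have hW : 0 ≤ ∑ i, weight f₀ K h e s i := Finset.sum_nonneg fun i _ => weight_nonneg hf₀ he s i
  have hq : ∀ i, 0 ≤ drawProb f₀ K h e s i := fun i => div_nonneg (weight_nonneg hf₀ he s i) hW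
  unfold drawCdf drawLaw
  rw [measureReal_def, Measure.finsetSum_apply, ENNReal.toReal_sum, Finset.sum_div]
  · refine Finset.sum_congr rfl fun i _ => ?_
    rw [Measure.smul_apply, Measure.dirac_apply' _ measurableSet_Iic, smul_eq_mul,
      ENNReal.toReal_mul, ENNReal.toReal_ofReal (hq i)]
    by_cases hi : s i ∈ Set.Iic x <;> simp [hi, drawProb]
  · intro i _
    rw [Measure.smul_apply, Measure.dirac_apply' _ measurableSet_Iic]
    by_cases hi : s i ∈ Set.Iic x <;> simp [hi]

/-- Stability of a normalized sum: a ratio `A / B` with `0 ≤ A ≤ B` is close to `F` as soon as `A`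
is close to `F` and `B` is close to `1`. -/
theorem abs_div_sub_le {A B F : ℝ} (hA : 0 ≤ A) (hAB : A ≤ B) :
    |A / B - F| ≤ |B - 1| + |A - F| := by
  rcases (hA.trans hAB).eq_or_lt with hB | hB
  -- Here `A / B = 0 / 0 = 0`, the convention for vanishing weights, and the bound is trivial.
  · have : A = 0 := le_antisymm (hB ▸ hAB) hA
    simp [← hB, this]
  · have h1 : |A / B - A| ≤ |B - 1| := by
      have h2 : A / B - A = A / B * (1 - B) := by field_simp
      rw [h2, abs_mul, abs_of_nonneg (by positivity), abs_sub_comm 1 B]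
      exact mul_le_of_le_one_left (abs_nonneg _) ((div_le_one hB).2 hAB)
    calc |A / B - F| ≤ |A / B - A| + |A - F| := abs_sub_le _ _ _
      _ ≤ _ := by gcongr

variable {f : ℝ → ℝ} {P P₀ : Measure ℝ}

/-- Importance-sampling identity: integrals against the target law are integrals against the
sampling law weighted by the density ratio. -/
theorem integral_mul_density_ratio (hf : IsDensityOf f P) (hf₀ : IsDensityOf f₀ P₀)
    (hsupp : Function.support f₀ ≤ᵐ[volume] Function.support f) (g : ℝ → ℝ) :
    ∫ y, g y * (f₀ y / f y) ∂P = ∫ y, g y ∂P₀ := by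
  rw [hf.integral_eq, hf₀.integral_eq]
  refine integral_congr_ae ?_
  filter_upwards [hsupp] with y hy
  -- The support inclusion excludes, almost everywhere, division by zero where `f₀` is nonzero.
  rcases eq_or_ne (f₀ y) 0 with h0 | h0
  · simp [h0]
  · have : f y ≠ 0 := hy h0
    field_simp

theorem integrable_density_ratio [IsProbabilityMeasure P₀] (hf : IsDensityOf f P)
    (hf₀ : IsDensityOf f₀ P₀) (hsupp : Function.support f₀ ≤ᵐ[volume] Function.support f) :
    Integrable (fun y => f₀ y / f y) P := by
  rw [hf.integrable_iff]
  refine hf₀.integrable.congr ?_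
  filter_upwards [hsupp] with y hy
  rcases eq_or_ne (f₀ y) 0 with h0 | h0
  · simp [h0]
  · have : f y ≠ 0 := hy h0
    field_simp

variable {Ω : Type*} [MeasurableSpace Ω] {μ : Measure Ω} [IsProbabilityMeasure μ]
  {X : ℕ → Ω → ℝ}

theorem measurable_weight (hf₀ : Measurable f₀) (hK : Measurable K) (hXm : ∀ i, Measurable (X i))
    (h e : ℝ) {n : ℕ} (i : Fin n) :
    Measurable fun ω => weight f₀ K h e (fun j : Fin n => X j ω) i := by
  unfold weight trimmedKde kde
  have h1 : ∀ j : Fin n, Measurable fun ω => K ((X j ω - X i ω) / h) := fun j =>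
    hK.comp (((hXm j).sub (hXm i)).div_const h)
  exact (hf₀.comp (hXm i)).div (((Finset.measurable_sum Finset.univ fun j _ => h1 j).const_mul
    _).max measurable_const)

/-- Mean error made by substituting the estimated drawing weight for the density ratio. -/
theorem lintegral_abs_weight_sub_le (hXm : ∀ i, Measurable (X i)) (hXind : iIndepFun X μ)
    (hXlaw : ∀ i, μ.map (X i) = P) (hf : IsDensityOf f P) (hf₀m : Measurable f₀)
    (hf₀ : ∀ y, 0 ≤ f₀ y) (hK : Measurable K) {h e : ℝ} {n : ℕ} {b : ℝ → ℝ}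
    (hb : ∀ s : Finset ℕ, s.card + 1 = n → ∀ y, ∫⁻ ω, ENNReal.ofReal |f y /
      max (1 / (n * h) * (K 0 + ∑ j ∈ s, K ((X j ω - y) / h))) e - 1| ∂μ ≤ ENNReal.ofReal (b y))
    (i : Fin n) :
    ∫⁻ ω, ENNReal.ofReal |weight f₀ K h e (fun j : Fin n => X j ω) i -
        f₀ (X i ω) / f (X i ω)| ∂μ ≤ ∫⁻ y, ENNReal.ofReal (f₀ y / f y * b y) ∂P := by
  set T : Finset ℕ := (Finset.range n).erase i with hTdef
  have hT : T.card + 1 = n := by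
    rw [hTdef, Finset.card_erase_add_one (Finset.mem_range.2 i.2), Finset.card_range]
  have hind : IndepFun (X i) (fun ω (j : T) => X j ω) μ := by
    have h1 := hXind.indepFun_finset {(i : ℕ)} T (by simp [hTdef]) hXm
    exact h1.comp (measurable_pi_apply (⟨i, Finset.mem_singleton_self _⟩ : ({(i : ℕ)} : Finset ℕ)))
      measurable_id
  let Φ : ℝ × (T → ℝ) → ENNReal := fun p => ENNReal.ofReal
    |f₀ p.1 / max (1 / (n * h) * (K 0 + ∑ j : T, K ((p.2 j - p.1) / h))) e - f₀ p.1 / f p.1|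
  have hΦ : Measurable Φ := by
    have h1 : ∀ j : T, Measurable fun p : ℝ × (T → ℝ) => K ((p.2 j - p.1) / h) := fun j =>
      hK.comp (by fun_prop)
    have h2 : Measurable fun p : ℝ × (T → ℝ) => f₀ p.1 / f p.1 :=
      (hf₀m.comp measurable_fst).div (hf.measurable.comp measurable_fst)
    exact ((((hf₀m.comp measurable_fst).div
      ((((Finset.measurable_sum Finset.univ fun j _ => h1 j).const_add _).const_mul _).max
        measurable_const)).sub h2).abs).ennreal_ofReal
  have hYm : Measurable fun ω (j : T) => X j ω := measurable_pi_lambda _ fun j => hXm j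
  have hlhs : ∀ ω, ENNReal.ofReal |weight f₀ K h e (fun j : Fin n => X j ω) i -
      f₀ (X i ω) / f (X i ω)| = Φ (X i ω, fun j : T => X j ω) := fun ω => by
    rw [weight_eq_loo h e (fun j => X j ω) i]
  simp only [hlhs]
  rw [lintegral_indepFun_eq (hXm i) hYm hind hΦ, hXlaw]
  refine lintegral_mono_ae ?_
  filter_upwards [hf.ae_pos] with y hy
  have hr : 0 ≤ f₀ y / f y := div_nonneg (hf₀ y) hy.le
  -- As `f y > 0`, the difference of weights factors as f₀/max − f₀/f = (f₀/f)(f/max − 1).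
  have hpt : ∀ ω, Φ (y, fun j : T => X j ω) = ENNReal.ofReal (f₀ y / f y) *
      ENNReal.ofReal |f y / max (1 / (n * h) * (K 0 + ∑ j ∈ T, K ((X j ω - y) / h))) e - 1| :=
    fun ω => by
      rw [← ENNReal.ofReal_mul hr, ← abs_of_nonneg hr, ← abs_mul]
      simp only [Φ]
      rw [Finset.sum_coe_sort T (fun j => K ((X j ω - y) / h))]
      congr 2
      field_simp
  simp only [hpt]
  rw [lintegral_const_mul' _ _ ENNReal.ofReal_ne_top, ENNReal.ofReal_mul hr]
  gcongr
  exact hb T hT y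

end Weights

/-! ### Convergence in probability -/

section Convergence

/-- Domination principle for convergence in probability of a sequence of functions whose distance
to the limit is bounded by terms vanishing in probability. -/
theorem tendstoInMeasure_of_abs_sub_le {Ω : Type*} [MeasurableSpace Ω]
    {μ : Measure Ω} {G T A B : ℕ → Ω → ℝ} {F a b : ℝ}
    (hT : TendstoInMeasure μ T atTop fun _ => 0) (hA : TendstoInMeasure μ A atTop fun _ => a)
    (hB : TendstoInMeasure μ B atTop fun _ => b)
    (hG : ∀ᶠ n in atTop, ∀ ω, |G n ω - F| ≤ 2 * |T n ω| + |A n ω - a| + |B n ω - b|) :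
    TendstoInMeasure μ G atTop fun _ => F := by
  rw [tendstoInMeasure_iff_norm] at hT hA hB ⊢
  intro ε hε
  have h4 : 0 < ε / 4 := by positivity
  have hsum := ((hT (ε / 4) h4).add (hA (ε / 4) h4)).add (hB (ε / 4) h4)
  rw [add_zero, add_zero] at hsum
  refine tendsto_of_tendsto_of_tendsto_of_le_of_le' tendsto_const_nhds hsum
    (.of_forall fun n => zero_le) ?_
  filter_upwards [hG] with n hn
  refine (measure_mono fun ω hω => ?_).trans ((measure_union_le _ _).trans
    (add_le_add (measure_union_le _ _) le_rfl))
  simp only [Set.mem_union, Set.mem_ofPred_eq, Real.norm_eq_abs, sub_zero] at hω ⊢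
  by_contra! hlt
  have := hn ω
  linarith [hlt.1.1, hlt.1.2, hlt.2]

variable {f₀ K f : ℝ → ℝ} {P P₀ : Measure ℝ} [IsProbabilityMeasure P₀]
  {Ω : Type*} [MeasurableSpace Ω] {μ : Measure Ω} [IsProbabilityMeasure μ] {X : ℕ → Ω → ℝ}
  {k : ℕ} {h e : ℕ → ℝ}

/-- The average error made by substituting the estimated drawing weights for the density ratios
converges to `0` in probability. -/
theorem tendstoInMeasure_average_weight_error [IsProbabilityMeasure P] (hXm : ∀ i, Measurable (X i))
    (hXind : iIndepFun X μ) (hXlaw : ∀ i, μ.map (X i) = P) (hf : IsDensityOf f P)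
    (hf₀ : IsDensityOf f₀ P₀) (hK : IsClassicalKernel k K) (hh : ∀ n, 1 ≤ n → 0 < h n)
    (he : ∀ n, 1 ≤ n → 0 < e n) (he0 : Tendsto e atTop (𝓝 0)) (hC : ConditionC k f h e)
    (hsupp : Function.support f₀ ≤ᵐ[volume] Function.support f) :
    TendstoInMeasure μ (fun (n : ℕ) ω => (n : ℝ)⁻¹ * ∑ i : Fin n,
      |weight f₀ K (h n) (e n) (fun j : Fin n => X j ω) i - f₀ (X i ω) / f (X i ω)|)
      atTop (fun _ => 0) := by
  obtain ⟨V, c, D, hV, hc, hD, hlim, hbound⟩ :=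
    exists_lintegral_relative_error_le hXm hXind hXlaw hf hK hh he he0 hC
  set b : ℕ → ℝ → ℝ := fun n y => ratioBound V c D (f y) (looMean K f (h n) n y) (e n) with hb
  have hrm : Measurable fun y => f₀ y / f y := hf₀.measurable.div hf.measurable
  have hbm : ∀ n, Measurable (b n) := fun n =>
    measurable_ratioBound hf.measurable (measurable_looMean hK.measurable hf.measurable _ _)
  have hepos : ∀ᶠ n in atTop, 0 < e n := (eventually_ge_atTop 1).mono he
  have hterm : ∀ (n : ℕ) (i : Fin n), Measurable fun ω =>
      |weight f₀ K (h n) (e n) (fun j : Fin n => X j ω) i - f₀ (X i ω) / f (X i ω)| := fun n i =>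
    ((measurable_weight hf₀.measurable hK.measurable hXm _ _ i).sub (hrm.comp (hXm i))).abs
  -- Dominated convergence: the crude bound on the relative error times the integrable ratio f₀/f
  -- dominates.
  have hzero : Tendsto (fun n => ∫⁻ y, ENNReal.ofReal (f₀ y / f y * b n y) ∂P) atTop (𝓝 0) := by
    have hdom := tendsto_lintegral_of_dominated_convergence (μ := P) (f := fun _ => 0)
      (F := fun n y => ENNReal.ofReal (f₀ y / f y * b n y))
      (fun y => ENNReal.ofReal (f₀ y / f y * ((V + 2 + D) / c + 1)))
      (fun n => (hrm.mul (hbm n)).ennreal_ofReal) (fun n => .of_forall fun y => ?_) ?_ ?_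
    · simpa using hdom
    · simp only
      have := div_nonneg (hf₀.nonneg y) (hf.nonneg y)
      gcongr
      exact ratioBound_le
    · exact ((integrable_density_ratio hf hf₀ hsupp).mul_const _).lintegral_lt_top.ne
    · filter_upwards [hf.ae_pos] with y hy
      rw [← ENNReal.ofReal_zero, ← mul_zero (f₀ y / f y)]
      exact ENNReal.tendsto_ofReal
        ((tendsto_ratioBound hV hc hD hy (hlim y) he0 hepos).const_mul _)
  refine tendstoInMeasure_of_tendsto_eLpNorm one_ne_zero (fun n => ?_) ?_ ?_
  · exact ((Finset.measurable_sum Finset.univ fun i _ => hterm n i).const_mul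
      _).aestronglyMeasurable
  · exact aestronglyMeasurable_const
  · refine tendsto_of_tendsto_of_tendsto_of_le_of_le' tendsto_const_nhds hzero
      (.of_forall fun n => zero_le) ?_
    filter_upwards [hbound, eventually_ge_atTop 1] with n hn hn1
    have hn0 : (n : ENNReal) ≠ 0 := by exact_mod_cast (by omega : n ≠ 0)
    rw [eLpNorm_one_eq_lintegral_enorm]
    have hrew : ∀ ω, ‖((fun ω => (n : ℝ)⁻¹ * ∑ i : Fin n,
        |weight f₀ K (h n) (e n) (fun j : Fin n => X j ω) i - f₀ (X i ω) / f (X i ω)|) -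
          (fun _ => 0 : Ω → ℝ)) ω‖ₑ = (n : ENNReal)⁻¹ * ∑ i : Fin n, ENNReal.ofReal
        |weight f₀ K (h n) (e n) (fun j : Fin n => X j ω) i - f₀ (X i ω) / f (X i ω)| :=
      fun ω => by
        simp only [Pi.sub_apply, sub_zero]
        rw [Real.enorm_of_nonneg (by positivity), ENNReal.ofReal_mul (by positivity),
          ENNReal.ofReal_inv_of_pos (by exact_mod_cast hn1), ENNReal.ofReal_natCast,
          ENNReal.ofReal_sum_of_nonneg fun i _ => abs_nonneg _]
    simp only [hrew]
    rw [lintegral_const_mul' _ _ (ENNReal.inv_ne_top.2 hn0),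
      lintegral_finsetSum _ fun i _ => (hterm n i).ennreal_ofReal]
    calc (n : ENNReal)⁻¹ * _ ≤ (n : ENNReal)⁻¹ *
          ∑ i : Fin n, ∫⁻ y, ENNReal.ofReal (f₀ y / f y * b n y) ∂P := by
          gcongr with i
          exact lintegral_abs_weight_sub_le hXm hXind hXlaw hf hf₀.measurable hf₀.nonneg
            hK.measurable hn i
      _ = ∫⁻ y, ENNReal.ofReal (f₀ y / f y * b n y) ∂P := by
          rw [Finset.sum_const, Finset.card_univ, Fintype.card_fin, nsmul_eq_mul, ← mul_assoc,
            ENNReal.inv_mul_cancel hn0 (ENNReal.natCast_ne_top n), one_mul]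

/-- Law of large numbers for averages weighted by the density ratio. -/
theorem tendstoInMeasure_average_density_ratio (hXm : ∀ i, Measurable (X i))
    (hXind : iIndepFun X μ) (hXlaw : ∀ i, μ.map (X i) = P) (hf : IsDensityOf f P)
    (hf₀ : IsDensityOf f₀ P₀) (hsupp : Function.support f₀ ≤ᵐ[volume] Function.support f)
    {s : Set ℝ} (hs : MeasurableSet s) :
    TendstoInMeasure μ (fun (n : ℕ) ω => (n : ℝ)⁻¹ * ∑ i : Fin n,
      s.indicator 1 (X i ω) * (f₀ (X i ω) / f (X i ω))) atTop (fun _ => P₀.real s) := by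
  let g : ℝ → ℝ := fun y => s.indicator 1 y * (f₀ y / f y)
  have h1m : Measurable (s.indicator (1 : ℝ → ℝ)) := measurable_one.indicator hs
  have hgm : Measurable g := h1m.mul (hf₀.measurable.div hf.measurable)
  have hgi : Integrable g P := by
    refine (integrable_density_ratio hf hf₀ hsupp).bdd_mul (c := 1) h1m.aestronglyMeasurable
      (.of_forall fun y => ?_)
    by_cases hy : y ∈ s <;> simp [hy]
  have hmean : ∫ y, g y ∂P = P₀.real s := by
    rw [integral_mul_density_ratio hf hf₀ hsupp, integral_indicator_one hs]
  have hlln := strong_law_ae_real (μ := μ) (fun i ω => g (X i ω))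
    (by
      rw [← hXlaw 0] at hgi
      exact hgi.comp_measurable (hXm 0))
    (fun i j hij => (hXind.indepFun hij).comp hgm hgm)
    (fun i => IdentDistrib.comp ⟨(hXm i).aemeasurable, (hXm 0).aemeasurable,
      by rw [hXlaw, hXlaw]⟩ hgm)
  have hE : ∫ ω, g (X 0 ω) ∂μ = P₀.real s := by
    rw [← hmean, ← hXlaw 0, integral_map (hXm 0).aemeasurable hgm.aestronglyMeasurable]
  refine tendstoInMeasure_of_tendsto_ae (fun n => ?_) ?_
  · exact ((Finset.measurable_sum Finset.univ fun (i : Fin n) _ =>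
      hgm.comp (hXm i)).const_mul _).aestronglyMeasurable
  · filter_upwards [hlln] with ω hω
    rw [hE] at hω
    refine hω.congr fun n => ?_
    rw [← Fin.sum_univ_eq_sum_range (fun i => g (X i ω)), div_eq_inv_mul]

end Convergence

end WeightedResampling

theorem proposition1
    {Ω : Type*} [MeasurableSpace Ω] (μ : Measure Ω) [IsProbabilityMeasure μ]
    -- the law of the covariate and the target law, with their densities
    (P P₀ : Measure ℝ) [IsProbabilityMeasure P] [IsProbabilityMeasure P₀]
    (f f₀ : ℝ → ℝ)
    (hf : WeightedResampling.IsDensityOf f P) (hf₀ : WeightedResampling.IsDensityOf f₀ P₀)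
    -- the iid sample
    (X : ℕ → Ω → ℝ) (hXm : ∀ i, Measurable (X i)) (hXind : iIndepFun X μ)
    (hXlaw : ∀ i, μ.map (X i) = P)
    -- kernel, bandwidths, trimming sequence
    (k : ℕ) (K : ℝ → ℝ) (hK : WeightedResampling.IsClassicalKernel k K)
    (h e : ℕ → ℝ) (hh : ∀ n, 1 ≤ n → 0 < h n) (he : ∀ n, 1 ≤ n → 0 < e n)
    (he0 : Tendsto e atTop (𝓝 0))
    (hC : WeightedResampling.ConditionC k f h e)
    -- the support of the target is contained in the support of the covariate's law
    (hsupp : Function.support f₀ ≤ᵐ[volume] Function.support f)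
    (x : ℝ) :
    TendstoInMeasure μ
      (fun n ω => WeightedResampling.drawCdf f₀ K (h n) (e n) (fun i : Fin n => X i ω) x)
      atTop (fun _ => cdf P₀ x) := by
  -- Numerator and denominator are the averages for the sets `Iic x` and `univ`, so one law of large
  -- numbers serves both; the weight error enters once in each, hence the factor 2.
  refine WeightedResampling.tendstoInMeasure_of_abs_sub_le
    (WeightedResampling.tendstoInMeasure_average_weight_error hXm hXind hXlaw hf hf₀ hK hh he he0
      hC hsupp)
    (WeightedResampling.tendstoInMeasure_average_density_ratio hXm hXind hXlaw hf hf₀ hsupp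
      (measurableSet_Iic (a := x)))
    (WeightedResampling.tendstoInMeasure_average_density_ratio hXm hXind hXlaw hf hf₀ hsupp
      MeasurableSet.univ) ?_
  filter_upwards [eventually_ge_atTop 1] with n hn ω
  have hn0 : (0 : ℝ) < n := by exact_mod_cast hn
  set w : Fin n → ℝ := WeightedResampling.weight f₀ K (h n) (e n) fun j : Fin n => X j ω with hw
  have hw0 : ∀ i, 0 ≤ w i := WeightedResampling.weight_nonneg hf₀.nonneg (he n hn) _
  set r : Fin n → ℝ := fun i => f₀ (X i ω) / f (X i ω) with hr
  set T : ℝ := (n : ℝ)⁻¹ * ∑ i : Fin n, |w i - r i| with hT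
  have hT0 : 0 ≤ T := by positivity
  have happrox : ∀ s : Set ℝ, |(n : ℝ)⁻¹ * ∑ i : Fin n, s.indicator 1 (X i ω) * w i -
      (n : ℝ)⁻¹ * ∑ i : Fin n, s.indicator 1 (X i ω) * r i| ≤ T := fun s => by
    rw [← mul_sub, ← Finset.sum_sub_distrib, abs_mul, abs_of_pos (inv_pos.2 hn0)]
    refine mul_le_mul_of_nonneg_left ((Finset.abs_sum_le_sum_abs _ _).trans
      (Finset.sum_le_sum fun i _ => ?_)) (by positivity)
    by_cases hi : X i ω ∈ s <;> simp [hi]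
  have hI0 : ∀ i : Fin n, 0 ≤ (Set.Iic x).indicator (1 : ℝ → ℝ) (X i ω) := fun i =>
    Set.indicator_nonneg (fun _ _ => zero_le_one) _
  have hI1 : ∀ i : Fin n, (Set.Iic x).indicator (1 : ℝ → ℝ) (X i ω) ≤ 1 := fun i =>
    Set.indicator_le_self' (fun _ _ => zero_le_one) _
  have hA0 : 0 ≤ (n : ℝ)⁻¹ * ∑ i : Fin n, (Set.Iic x).indicator 1 (X i ω) * w i :=
    mul_nonneg (by positivity) (Finset.sum_nonneg fun i _ => mul_nonneg (hI0 i) (hw0 i))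
  have hAB : (n : ℝ)⁻¹ * ∑ i : Fin n, (Set.Iic x).indicator 1 (X i ω) * w i ≤
      (n : ℝ)⁻¹ * ∑ i : Fin n, w i :=
    mul_le_mul_of_nonneg_left (Finset.sum_le_sum fun i _ =>
      mul_le_of_le_one_left (hw0 i) (hI1 i)) (by positivity)
  have hratio := WeightedResampling.abs_div_sub_le (F := cdf P₀ x) hA0 hAB
  rw [mul_div_mul_left _ _ (inv_ne_zero hn0.ne')] at hratio
  rw [WeightedResampling.drawCdf_eq hf₀.nonneg (he n hn)]
  have h1 := happrox (Set.Iic x)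
  have h2 := happrox Set.univ
  simp only [Set.indicator_univ, Pi.one_apply, one_mul, probReal_univ] at h2 ⊢
  rw [← cdf_eq_real, abs_of_nonneg hT0]
  have h3 := abs_sub_le ((n : ℝ)⁻¹ * ∑ i : Fin n, (Set.Iic x).indicator 1 (X i ω) * w i)
    ((n : ℝ)⁻¹ * ∑ i : Fin n, (Set.Iic x).indicator 1 (X i ω) * r i) (cdf P₀ x)
  have h4 := abs_sub_le ((n : ℝ)⁻¹ * ∑ i : Fin n, w i) ((n : ℝ)⁻¹ * ∑ i : Fin n, r i) 1
  refine hratio.trans ?_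
  linarith
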